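/- Let $N\ge 1$, $0<p<1$, $q=1-p$. A point $(x,t)\in\mathbb Z^2$ stands for site $x$ at time $t$. An $N$-point configuration $(\bm x,\bm t)=((x_1,t_1),\dots,(x_N,t_N))$ is called admissible if $x_1>\dots>x_N$ and $t_1\le\dots\le t_N$. Paths and weights. A path from $(x^0,t^0)$ to $(x,t)$, where $t\ge t^0$, is a set $\{(x^s,s): t^0\le s\le t\}$ with $x^{t^0}=x^0$, $x^t=x$ and arbitrary integers $x^s$ in between (a single point if $t=t^0$). An $N$-path $\bm\Pi=(\Pi_1,\dots,\Pi_N)$ from $(\bm x^0,\bm t^0)$ to $(\bm x,\bm t)$ consists of paths $\Pi_i$ from $(x_i^0,t_i^0)$ to $(x_i,t_i)$. Its weight $W[\bm\Pi]$ is the product over $i$ and over the steps of $\Pi_i$ of the following elementary weights, where $\Pi_0=\emptyset$: a step $(x,t)\to(x+1,t+1)$ of $\Pi_i$ has weight $p$ if $(x+1,t+1)\notin\Pi_{i-1}$ and $0$ otherwise; a step $(x,t)\to(x,t+1)$ of $\Pi_i$ has weight $q$ if $(x+1,t+1)\notin\Pi_{i-1}$ and $1$ otherwise; every other step has weight $0$.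 The generalized Green function (GGF) $G((\bm x,\bm t)|(\bm x^0,\bm t^0))$ is the sum of $W[\bm\Pi]$ over all $N$-paths from $(\bm x^0,\bm t^0)$ to $(\bm x,\bm t)$ (zero if there are none). If $t_i''=t_i'+1$ for all $i$, then $W(\{(\bm x',\bm t'),(\bm x'',\bm t'')\})$ denotes the weight of the $N$-path consisting of the single steps $(x'_i,t'_i)\to(x''_i,t''_i)$. Boundaries. Let $\mathcal B=\{(b_k,s_k)\}_{k\in\mathbb Z}\subset\mathbb Z^2$ be such that for every $k$ either $(b_{k+1},s_{k+1})=(b_k+1,s_k)$ or $(b_{k+1},s_{k+1})=(b_k,s_k-1)$. Let $\mathcal B_i=\{(x-i+1,t):(x,t)\in\mathcal B\}$ for $i=1,\dots,N$, let $\bm{\mathcal B}=(\mathcal B_1,\dots,\mathcal B_N)$, and let $\tilde L_i=\{(x',t'): x'\le x,\ t'\le t \text{ for some } (x,t)\in\mathcal B_i\}$. An admissible configuration on $\bm{\mathcal B}$ is an admissible $(\bm x',\bm t')$ with $(x_i',t_i')\in\mathcal B_i$ for all $i$. Its exit probability is $$P_e^{\bm{\mathcal B}}((\bm x',\bm t'))=\sum_{(\bm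 x'',\bm t'')} W(\{(\bm x',\bm t'),(\bm x'',\bm t'')\}),$$ the sum being over all $(\bm x'',\bm t'')$ with $t_i''=t_i'+1$ and $(x_i'',t_i'')\notin\tilde L_i$ for all $i$. Statement. Let $(\bm x^0,\bm t^0)$ be admissible with $(x_i^0,t_i^0)\in\tilde L_i$ for all $i$. (1) The quantity $$\mathcal G^{\bm{\mathcal B}}((\bm x,\bm t)|(\bm x^0,\bm t^0))=P_e^{\bm{\mathcal B}}((\bm x,\bm t))\,G((\bm x,\bm t)|(\bm x^0,\bm t^0))$$ defines a probability measure on the set of admissible configurations on $\bm{\mathcal B}$; that is, its values are nonnegative and their sum over all admissible configurations $(\bm x,\bm t)$ on $\bm{\mathcal B}$ is $1$. (2) For every admissible $(\bm x,\bm t)$ with $(x_i,t_i)\notin\tilde L_i$ for all $i$, $$G((\bm x,\bm t)|(\bm x^0,\bm t^0))=\sum G((\bm x,\bm t)|(\bm x'',\bm t''))\,W(\{(\bm x',\bm t'),(\bm x'',\bm t'')\})\,G((\bm x',\bm t')|(\bm x^0,\bm t^0)),$$ the sum being over all admissible configurations $(\bm x',\bm t')$ on $\bm{\mathcal B}$ and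 all $(\bm x'',\bm t'')$ with $t_i''=t_i'+1$ and $(x_i'',t_i'')\notin\tilde L_i$ for all $i$. -/

import Mathlib

noncomputable section

namespace TASEP

/-- An indexed `N`-tuple of space-time points; a point is a pair `(x, t)` = (site, time). -/
abbrev Config (N : ℕ) : Type := Fin N → ℤ × ℤ

/-- Admissible configurations: `x₁ > x₂ > ⋯ > x_N` and `t₁ ≤ t₂ ≤ ⋯ ≤ t_N`. -/
def Admissible {N : ℕ} (c : Config N) : Prop :=
  StrictAnti (fun i => (c i).1) ∧ Monotone (fun i => (c i).2)

open Classical in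
/-- The elementary weight of the step from `a` to `b`, given the path `S` of the preceding
particle (`S = ∅` if there is none): a jump has weight `p`, or `0` if its target lies on `S`;
staying put has weight `q = 1 - p`, or `1` if the target of the jump lies on `S`;
all other steps have weight `0`. -/
def elemWeight (p : ℝ) (S : Set (ℤ × ℤ)) (a b : ℤ × ℤ) : ℝ :=
  if b = (a.1 + 1, a.2 + 1) then (if (a.1 + 1, a.2 + 1) ∈ S then 0 else p)
  else if b = (a.1, a.2 + 1) then (if (a.1 + 1, a.2 + 1) ∈ S then 1 else 1 - p)
  else 0

/-- An `N`-path from `c₀` to `c`. The `i`-th path is recorded by its position `pos i s` at every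
time `s` of the window from `(c₀ i).2` to `(c i).2`; so that different records are different
paths, `pos i` is extended by constants outside of the window. The positions strictly inside
the window are arbitrary. -/
structure NPath {N : ℕ} (c₀ c : Config N) where
  /-- positions of the particles -/
  pos : Fin N → ℤ → ℤ
  time_le : ∀ i, (c₀ i).2 ≤ (c i).2
  pos_start : ∀ i s, s ≤ (c₀ i).2 → pos i s = (c₀ i).1
  pos_end : ∀ i s, (c i).2 ≤ s → pos i s = (c i).1

/-- The set of points of the `i`-th path, for paths from `c₀` to `c` with positions `pos`. -/
def pathPoints {N : ℕ} (c₀ c : Config N) (pos : Fin N → ℤ → ℤ) (i : Fin N) : Set (ℤ × ℤ) :=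
  {z | (c₀ i).2 ≤ z.2 ∧ z.2 ≤ (c i).2 ∧ z.1 = pos i z.2}

/-- The path of the particle that precedes the `i`-th one; empty for the first particle. -/
def precedingPath {N : ℕ} (c₀ c : Config N) (pos : Fin N → ℤ → ℤ) (i : Fin N) : Set (ℤ × ℤ) :=
  {z | ∃ j : Fin N, j.val + 1 = i.val ∧ z ∈ pathPoints c₀ c pos j}

/-- The weight `W[Π₁] ∏ W[Π_{i+1} | Π_i]` of the `N`-path from `c₀` to `c` with positions
`pos`. -/
def pathWeight {N : ℕ} (p : ℝ) (c₀ c : Config N) (pos : Fin N → ℤ → ℤ) : ℝ :=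
  ∏ i, ∏ s ∈ Finset.Ico (c₀ i).2 (c i).2,
    elemWeight p (precedingPath c₀ c pos i) (pos i s, s) (pos i (s + 1), s + 1)

/-- The generalized Green function `G(c | c₀)`: the sum of the weights of all `N`-paths from `c₀`
to `c` (only finitely many weights are nonzero). -/
def GGF {N : ℕ} (p : ℝ) (c c₀ : Config N) : ℝ :=
  ∑' π : NPath c₀ c, pathWeight p c₀ c π.pos

/-- The weight `W({c', c''})` of the `N`-path that consists of the single steps from `c' i`
to `c'' i`, where `c''` lies one time unit after `c'`. -/
def stepWeight {N : ℕ} (p : ℝ) (c' c'' : Config N) : ℝ :=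
  pathWeight p c' c'' (fun i s => if s ≤ (c' i).2 then (c' i).1 else (c'' i).1)

/-- Boundaries: bi-infinite staircases each of whose steps goes one site to the right or one
time unit down. -/
def IsBoundary (B : Set (ℤ × ℤ)) : Prop :=
  ∃ b : ℤ → ℤ × ℤ, Set.range b = B ∧
    ∀ i, b (i + 1) = ((b i).1 + 1, (b i).2) ∨ b (i + 1) = ((b i).1, (b i).2 - 1)

/-- The domain `L̃` that is bounded by `B`. -/
def under (B : Set (ℤ × ℤ)) : Set (ℤ × ℤ) :=
  {z | ∃ b ∈ B, z.1 ≤ b.1 ∧ z.2 ≤ b.2}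

/-- The translation `T_n` of a set of space-time points by `n` steps in space. -/
def translate (n : ℤ) (B : Set (ℤ × ℤ)) : Set (ℤ × ℤ) :=
  (fun z : ℤ × ℤ => (z.1 + n, z.2)) '' B

/-- The `N`-boundary `(B, T_{-1} B, …, T_{-N+1} B)`. -/
def NBoundary (N : ℕ) (B : Set (ℤ × ℤ)) : Fin N → Set (ℤ × ℤ) :=
  fun i => translate (-(i.val : ℤ)) B

/-- The admissible configurations on the `N`-boundary of `B`. -/
def BoundaryConfig (N : ℕ) (B : Set (ℤ × ℤ)) : Type :=
  {c : Config N // Admissible c ∧ ∀ i, c i ∈ NBoundary N B i}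

/-- The configurations one time unit after `c'` whose `i`-th point is outside of the domain
bounded by the `i`-th boundary, for every `i`. -/
def ExitTarget {N : ℕ} (B : Set (ℤ × ℤ)) (c' : Config N) : Type :=
  {c'' : Config N // ∀ i, (c'' i).2 = (c' i).2 + 1 ∧ c'' i ∉ under (NBoundary N B i)}

/-- The exit probability `P_e`: the total weight of the steps from `c'` that leave. -/
def exitProb {N : ℕ} (p : ℝ) (B : Set (ℤ × ℤ)) (c' : Config N) : ℝ :=
  ∑' c'' : ExitTarget B c', stepWeight p c' c''.1

end TASEP

end

namespace TASEP
open scoped ENNReal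

/-! ### Geometry of the domains -/

/-! Each domain is closed under decreasing site or time, and a path of nonzero weight is
nondecreasing in both. A path from inside to outside therefore leaves its domain at exactly one
step, and that step starts on the staircase.

For an `N`-path the decisive point is that consecutive domains differ by a shift of one site
(`mem_domain_next`): a particle is in its domain exactly when the site to its right is in the
predecessor's domain. Together with exclusion this makes the last points inside admissible
(`NPath.admissible_exit`). It also makes each elementary weight depend only on the matching piece of
the predecessor's path, so the weight is the product of the weights before, at and after the exit
(`pathWeight_split`). Cutting and gluing is then a weight-preserving bijection between paths of
nonzero weight and triples of nonzero total weight; this is (2).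

For (1), the same bijection identifies the total mass with the weight of all `N`-paths stopped on
leaving the domains. Given the path of its predecessor, a particle is a walker whose two step
weights sum to one; it leaves its domain almost surely because obstacles end at a finite time and
the domain is eventually bounded on the right (`tsum_exitWeight`). Only the next particle depends on
a given path, so the last particle can be summed out repeatedly (`tsum_chain`).

Sums are rearranged in `ℝ≥0∞`; finiteness of the supports of `GGF` and `exitProb` allows the return
to `ℝ`. -/

lemma under_of_le {B : Set (ℤ × ℤ)} {a z : ℤ × ℤ} (hz : z ∈ under B) (h1 : a.1 ≤ z.1)
    (h2 : a.2 ≤ z.2) : a ∈ under B := by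
  obtain ⟨b, hb, h3, h4⟩ := hz
  exact ⟨b, hb, h1.trans h3, h2.trans h4⟩

lemma mem_translate {n : ℤ} {B : Set (ℤ × ℤ)} {z : ℤ × ℤ} :
    z ∈ translate n B ↔ (z.1 - n, z.2) ∈ B := by
  constructor
  · rintro ⟨y, hy, rfl⟩
    simpa using hy
  · intro h
    exact ⟨_, h, by simp⟩

lemma mem_under_translate {n : ℤ} {B : Set (ℤ × ℤ)} {z : ℤ × ℤ} :
    z ∈ under (translate n B) ↔ (z.1 - n, z.2) ∈ under B := by
  constructor
  · rintro ⟨b, hb, h1, h2⟩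
    exact ⟨_, mem_translate.1 hb, by simpa using h1, h2⟩
  · rintro ⟨b, hb, h1, h2⟩
    refine ⟨(b.1 + n, b.2), mem_translate.2 (by simpa using hb), ?_, h2⟩
    simp only at h1 ⊢
    omega

/-- Each step raises site minus time by one, so the staircase meets every diagonal of constant
difference exactly once. -/
lemma IsBoundary.exists_staircase {B : Set (ℤ × ℤ)} (hB : IsBoundary B) :
    ∃ b : ℤ → ℤ × ℤ, Set.range b = B ∧ (Monotone fun k => (b k).1) ∧
      (Antitone fun k => (b k).2) ∧ ∀ k, (b k).1 - (b k).2 = (b 0).1 - (b 0).2 + k := by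
  obtain ⟨b, hb, hs⟩ := hB
  refine ⟨b, hb, monotone_int_of_le_succ fun k => ?_, antitone_int_of_succ_le fun k => ?_,
    fun k => ?_⟩
  · rcases hs k with h | h <;> simp [h]
  · rcases hs k with h | h <;> simp [h]
  · induction k using Int.induction_on with
    | zero => simp
    | succ k ih => rcases hs k with h | h <;> simp only [h] <;> omega
    | pred k ih =>
      have := hs (-k - 1)
      rw [sub_add_cancel] at this
      rcases this with h | h <;> simp only [h] at ih <;> omega

/-- A staircase consists of the points of its domain that a diagonal step takes out of it. -/
lemma IsBoundary.mem_iff {B : Set (ℤ × ℤ)} (hB : IsBoundary B) (z : ℤ × ℤ) :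
    z ∈ B ↔ z ∈ under B ∧ (z.1 + 1, z.2 + 1) ∉ under B := by
  obtain ⟨b, rfl, hm, ha, hd⟩ := hB.exists_staircase
  constructor
  · rintro ⟨k, rfl⟩
    refine ⟨⟨_, ⟨k, rfl⟩, le_rfl, le_rfl⟩, ?_⟩
    rintro ⟨_, ⟨j, rfl⟩, h1, h2⟩
    rcases le_total j k with h | h
    · have := hm h
      simp only at this h1
      omega
    · have := ha h
      simp only at this h2
      omega
  · rintro ⟨⟨_, ⟨j, rfl⟩, h1, h2⟩, h⟩
    -- The index of the staircase point on the diagonal through `z`. If that point were further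
    -- along, `z + (1, 1)` would still be under it; if it were further back, no staircase point
    -- could dominate `z`.
    refine ⟨z.1 - z.2 - ((b 0).1 - (b 0).2), ?_⟩
    set k := z.1 - z.2 - ((b 0).1 - (b 0).2) with hk
    have h3 := hd k
    have h4 : ¬ z.1 < (b k).1 := fun h5 => h ⟨_, ⟨k, rfl⟩, by simp only; omega, by simp only; omega⟩
    have h5 : ¬ (b k).1 < z.1 := by
      intro h6
      rcases le_total j k with h | h
      · have := hm h
        simp only at this
        omega
      · have := ha h
        simp only at this
        omega
    apply Prod.ext <;> omega

/-- Above the time of `b 0` only points of nonpositive index can dominate, and their sites are at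
most that of `b 0`. -/
lemma IsBoundary.exists_bound {B : Set (ℤ × ℤ)} (hB : IsBoundary B) :
    ∃ M T : ℤ, ∀ z ∈ under B, T ≤ z.2 → z.1 ≤ M := by
  obtain ⟨b, rfl, hm, ha, hd⟩ := hB.exists_staircase
  refine ⟨(b 0).1, (b 0).2 + 1, ?_⟩
  rintro z ⟨_, ⟨j, rfl⟩, h1, h2⟩ h3
  have hj : j ≤ 0 := by
    by_contra hj
    have := ha (not_le.1 hj).le
    simp only at this
    omega
  exact h1.trans (hm hj)

/-- The domain of the `i`-th particle. -/
def domain (N : ℕ) (B : Set (ℤ × ℤ)) (i : Fin N) : Set (ℤ × ℤ) := under (NBoundary N B i)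

section domain
variable {N : ℕ} {B : Set (ℤ × ℤ)}

lemma domain_of_le {i : Fin N} {x t y s : ℤ} (hz : (y, s) ∈ domain N B i) (h1 : x ≤ y)
    (h2 : t ≤ s) : (x, t) ∈ domain N B i := under_of_le hz h1 h2

lemma mem_domain {i : Fin N} {z : ℤ × ℤ} :
    z ∈ domain N B i ↔ (z.1 + i.val, z.2) ∈ under B := by
  rw [domain, NBoundary, mem_under_translate, sub_neg_eq_add]

/-- The geometric hinge of the proof: it compares the jump target of a particle with the domain of
its predecessor. -/
lemma mem_domain_next {i j : Fin N} (h : j.val + 1 = i.val) {x t : ℤ} :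
    (x, t) ∈ domain N B i ↔ (x + 1, t) ∈ domain N B j := by
  rw [mem_domain, mem_domain, ← h]
  push_cast
  rw [add_assoc x 1, add_comm (1 : ℤ)]

lemma mem_NBoundary (hB : IsBoundary B) {i : Fin N} {z : ℤ × ℤ} :
    z ∈ NBoundary N B i ↔ z ∈ domain N B i ∧ (z.1 + 1, z.2 + 1) ∉ domain N B i := by
  rw [NBoundary, mem_translate, hB.mem_iff, mem_domain, mem_domain, sub_neg_eq_add]
  simp only
  rw [add_right_comm]

lemma domain_exists_bound (hB : IsBoundary B) (i : Fin N) :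
    ∃ M T : ℤ, ∀ z ∈ domain N B i, T ≤ z.2 → z.1 ≤ M := by
  obtain ⟨M, T, h⟩ := hB.exists_bound
  refine ⟨M - i.val, T, fun z hz hT => ?_⟩
  have := h _ (mem_domain.1 hz) hT
  simp only at this
  omega

end domain

/-! ### Sums over chains -/

/-- If the conditional weights of every coordinate, given the preceding one, sum to one, then
so do their products. -/
lemma tsum_chain {α P : Type*} (Q : Set P → Prop) (h0 : Q ∅) :
    ∀ (N : ℕ) (pts : Fin N → α → Set P) (k : Fin N → Set P → α → ℝ≥0∞),
      (∀ i a, Q (pts i a)) → (∀ i S, Q S → ∑' a, k i S a = 1) →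
      ∑' w : Fin N → α, ∏ i, k i {z | ∃ j : Fin N, j.val + 1 = i.val ∧ z ∈ pts j (w j)} (w i) = 1
  | 0, pts, k, _, _ => by simp
  | N + 1, pts, k, hp, hk => by
    rw [← (Fin.snocEquiv fun _ : Fin (N + 1) => α).tsum_eq]
    have key : ∀ x : α × (Fin N → α),
        (∏ i, k i {z | ∃ j : Fin (N + 1), j.val + 1 = i.val ∧
          z ∈ pts j ((Fin.snocEquiv fun _ : Fin (N + 1) => α) x j)}
            ((Fin.snocEquiv fun _ : Fin (N + 1) => α) x i)) =
        (∏ i : Fin N, k i.castSucc {z | ∃ j : Fin N, j.val + 1 = i.val ∧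
          z ∈ pts j.castSucc (x.2 j)} (x.2 i)) *
        k (Fin.last N) {z | ∃ j : Fin N, j.val + 1 = N ∧ z ∈ pts j.castSucc (x.2 j)} x.1 := by
      rintro ⟨a, w⟩
      have hset : ∀ i : Fin (N + 1), {z | ∃ j : Fin (N + 1), j.val + 1 = i.val ∧
          z ∈ pts j ((Fin.snocEquiv fun _ : Fin (N + 1) => α) (a, w) j)} =
          {z | ∃ j : Fin N, j.val + 1 = i.val ∧ z ∈ pts j.castSucc (w j)} := by
        intro i
        ext z
        constructor
        · rintro ⟨j, hj, hz⟩
          obtain ⟨j, rfl⟩ : ∃ j' : Fin N, j = j'.castSucc :=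
            ⟨⟨j, by omega⟩, rfl⟩
          exact ⟨j, hj, by simpa [Fin.snocEquiv] using hz⟩
        · rintro ⟨j, hj, hz⟩
          exact ⟨j.castSucc, hj, by simpa [Fin.snocEquiv] using hz⟩
      rw [Fin.prod_univ_castSucc]
      simp only [hset]
      simp [Fin.snocEquiv]
    simp only [key]
    -- The last coordinate occurs only in its own factor, so it is summed first, with the others
    -- fixed. `Q` guarantees that the obstacle set it sees is one for which the conditional sum is
    -- one.
    rw [ENNReal.tsum_prod', ENNReal.tsum_comm]
    have hQ : ∀ w : Fin N → α, Q {z | ∃ j : Fin N, j.val + 1 = N ∧ z ∈ pts j.castSucc (w j)} := by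
      intro w
      rcases N with _ | n
      · convert h0
        ext z
        simp
      · convert hp (Fin.last n).castSucc (w (Fin.last n))
        ext z
        constructor
        · rintro ⟨j, hj, hz⟩
          obtain rfl : j = Fin.last n := by ext; simp; omega
          exact hz
        · intro hz
          exact ⟨Fin.last n, by simp, hz⟩
    simp only [ENNReal.tsum_mul_left, hk _ _ (hQ _), mul_one]
    exact tsum_chain Q h0 N (fun i => pts i.castSucc) (fun i => k i.castSucc)
      (fun i => hp _) (fun i => hk _)

/-! ### A single walker -/

/-- The point after a step from `z`, which is a jump if `b` is true. -/
def nextPoint (z : ℤ × ℤ) (b : Bool) : ℤ × ℤ := (z.1 + if b then 1 else 0, z.2 + 1)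

/-- The positions of a walker who starts at `z` and follows the word `l`, extended by
constants. -/
def walk : ℤ × ℤ → List Bool → ℤ → ℤ
  | z, [], _ => z.1
  | z, b :: l, s => if s ≤ z.2 then z.1 else walk (nextPoint z b) l s

open Classical in
/-- The weight of the word `l` for a walker who starts at `z`, provided that the word ends
when the walker leaves `L`. -/
noncomputable def exitWeight (p : ℝ) (S L : Set (ℤ × ℤ)) : ℤ × ℤ → List Bool → ℝ≥0∞
  | z, [] => if z ∈ L then 0 else 1
  | z, b :: l => if z ∈ L then
      ENNReal.ofReal (elemWeight p S z (nextPoint z b)) * exitWeight p S L (nextPoint z b) l else 0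

lemma elemWeight_nonneg {p : ℝ} (hp0 : 0 < p) (hp1 : p < 1) (S : Set (ℤ × ℤ)) (a b : ℤ × ℤ) :
    0 ≤ elemWeight p S a b := by
  unfold elemWeight
  split_ifs <;> linarith

lemma elemWeight_add (p : ℝ) (S : Set (ℤ × ℤ)) (z : ℤ × ℤ) :
    elemWeight p S z (nextPoint z true) + elemWeight p S z (nextPoint z false) = 1 := by
  unfold elemWeight nextPoint
  by_cases h : (z.1 + 1, z.2 + 1) ∈ S <;> simp [h]

lemma elemWeight_true {p : ℝ} {S : Set (ℤ × ℤ)} {z : ℤ × ℤ} (h : (z.1 + 1, z.2 + 1) ∉ S) :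
    elemWeight p S z (nextPoint z true) = p := by
  simp [elemWeight, nextPoint, h]

lemma tsum_list_bool (f : List Bool → ℝ≥0∞) :
    ∑' l, f l = f [] + (∑' l, f (true :: l) + ∑' l, f (false :: l)) := by
  let e : Unit ⊕ (Bool × List Bool) ≃ List Bool :=
    { toFun := Sum.elim (fun _ => []) fun x => x.1 :: x.2
      invFun := fun l => match l with
        | [] => Sum.inl ()
        | b :: l => Sum.inr (b, l)
      left_inv := by rintro (_ | ⟨b, l⟩) <;> rfl
      right_inv := by rintro (_ | ⟨b, l⟩) <;> rfl }
  rw [← e.tsum_eq, Summable.tsum_sum ENNReal.summable ENNReal.summable, ENNReal.tsum_prod',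
    tsum_bool, add_comm (∑' l, _) (∑' l, _)]
  simp [e]

section exit
variable {p : ℝ} (S L : Set (ℤ × ℤ))

lemma tsum_exitWeight_of_notMem {z : ℤ × ℤ} (hz : z ∉ L) : ∑' l, exitWeight p S L z l = 1 := by
  rw [tsum_list_bool]
  simp [exitWeight, hz]

lemma tsum_exitWeight_of_mem {z : ℤ × ℤ} (hz : z ∈ L) : ∑' l, exitWeight p S L z l =
    ENNReal.ofReal (elemWeight p S z (nextPoint z true)) *
      ∑' l, exitWeight p S L (nextPoint z true) l +
    ENNReal.ofReal (elemWeight p S z (nextPoint z false)) *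
      ∑' l, exitWeight p S L (nextPoint z false) l := by
  rw [tsum_list_bool]
  simp [exitWeight, hz, ENNReal.tsum_mul_left]

lemma ofReal_elemWeight_add (hp0 : 0 < p) (hp1 : p < 1) (z : ℤ × ℤ) :
    ENNReal.ofReal (elemWeight p S z (nextPoint z true)) +
      ENNReal.ofReal (elemWeight p S z (nextPoint z false)) = 1 := by
  rw [← ENNReal.ofReal_add (elemWeight_nonneg hp0 hp1 _ _ _) (elemWeight_nonneg hp0 hp1 _ _ _),
    elemWeight_add, ENNReal.ofReal_one]

lemma tsum_exitWeight_le_one (hp0 : 0 < p) (hp1 : p < 1) (z : ℤ × ℤ) : ∑' l, exitWeight p S L z l ≤ 1 := by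
  -- Truncation by word length gives an induction without presupposing that the walker leaves; any
  -- finite set of words has bounded length.
  have key : ∀ (n : ℕ) (z : ℤ × ℤ),
      ∑' l : List Bool, (if l.length ≤ n then exitWeight p S L z l else 0) ≤ 1 := by
    intro n
    induction n with
    | zero =>
      intro z
      rw [tsum_list_bool]
      simp only [List.length_nil, List.length_cons]
      simp only [le_refl, if_true, Nat.le_zero, Nat.succ_ne_zero, if_false, tsum_zero, add_zero,
        exitWeight]
      split_ifs <;> simp
    | succ n ih =>
      intro z
      rw [tsum_list_bool]
      by_cases hz : z ∈ L
      · simp only [List.length_nil, List.length_cons, exitWeight, hz, if_true, zero_le,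
          add_le_add_iff_right, zero_add, ← mul_ite_zero, ENNReal.tsum_mul_left]
        calc _ ≤ ENNReal.ofReal (elemWeight p S z (nextPoint z true)) * 1 +
              ENNReal.ofReal (elemWeight p S z (nextPoint z false)) * 1 := by
              gcongr <;> exact ih _
          _ = 1 := by rw [mul_one, mul_one, ofReal_elemWeight_add _ hp0 hp1]
      · simp [exitWeight, hz]
  rw [ENNReal.tsum_eq_iSup_sum]
  refine iSup_le fun s => ?_
  refine le_trans ?_ (key (s.sup List.length) z)
  refine le_trans (Finset.sum_le_sum fun l hl => ?_) (ENNReal.sum_le_tsum s)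
  rw [if_pos (Finset.le_sup (f := List.length) hl)]

/-- A walker almost surely leaves a domain that is eventually bounded from the right, if the
obstacles are bounded in time. -/
lemma tsum_exitWeight (hp0 : 0 < p) (hp1 : p < 1) (hL : ∃ M T : ℤ, ∀ z ∈ L, T ≤ z.2 → z.1 ≤ M)
    (hS : ∃ T : ℤ, ∀ z ∈ S, z.2 ≤ T) (z : ℤ × ℤ) : ∑' l, exitWeight p S L z l = 1 := by
  obtain ⟨M, T₁, hL⟩ := hL
  obtain ⟨T₂, hS⟩ := hS
  -- The probability of never leaving `L`: zero outside `L`, and inside it the average of its values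
  -- after one step.
  let D : ℤ × ℤ → ℝ := fun z => 1 - (∑' l, exitWeight p S L z l).toReal
  have hfin : ∀ z, ∑' l, exitWeight p S L z l ≠ ⊤ := fun z =>
    ((tsum_exitWeight_le_one S L hp0 hp1 z).trans_lt ENNReal.one_lt_top).ne
  have hD0 : ∀ z, 0 ≤ D z := fun z => by
    have := ENNReal.toReal_mono ENNReal.one_ne_top (tsum_exitWeight_le_one S L hp0 hp1 z)
    simpa [D] using this
  have hD1 : ∀ z, D z ≤ 1 := fun z => by simp [D]
  have hDout : ∀ z, z ∉ L → D z = 0 := fun z hz => by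
    simp [D, tsum_exitWeight_of_notMem S L hz]
  have hDin : ∀ z ∈ L, D z = elemWeight p S z (nextPoint z true) * D (nextPoint z true) +
      elemWeight p S z (nextPoint z false) * D (nextPoint z false) := fun z hz => by
    simp only [D]
    rw [tsum_exitWeight_of_mem S L hz, ENNReal.toReal_add
      (ENNReal.mul_ne_top ENNReal.ofReal_ne_top (hfin _))
      (ENNReal.mul_ne_top ENNReal.ofReal_ne_top (hfin _)), ENNReal.toReal_mul, ENNReal.toReal_mul,
      ENNReal.toReal_ofReal (elemWeight_nonneg hp0 hp1 _ _ _),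
      ENNReal.toReal_ofReal (elemWeight_nonneg hp0 hp1 _ _ _)]
    linear_combination (-1 : ℝ) * elemWeight_add p S z
  -- After both time bounds jumps are unobstructed while the walker is in `L`, and no site beyond
  -- `M` is in `L`. Induction is on the number of jumps that suffice to pass `M`.
  have late : ∀ (n : ℕ) (x t : ℤ), M - n < x → max T₁ T₂ ≤ t → D (x, t) = 0 := by
    intro n
    induction n with
    | zero =>
      intro x t hx ht
      refine hDout _ fun h => ?_
      have := hL _ h (le_trans (le_max_left _ _) ht)
      simp at this hx
      omega
    | succ n ih =>
      intro x t hx ht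
      -- A jump leads to defect zero by induction, so only waiting contributes; waiting forever has
      -- probability `lim (1 - p) ^ m = 0`.
      have step : ∀ t, max T₁ T₂ ≤ t → D (x, t) ≤ (1 - p) * D (x, t + 1) := by
        intro t ht
        by_cases hz : (x, t) ∈ L
        · have hns : (x + 1, t + 1) ∉ S := fun h => by
            have := hS _ h
            have := le_trans (le_max_right _ _) ht
            simp only at *
            omega
          have h1 := elemWeight_true (p := p) (z := (x, t)) hns
          have h2 := elemWeight_add p S (x, t)
          have h3 : D (nextPoint (x, t) true) = 0 := ih _ _ (by push_cast at hx; simp; omega)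
            (by simp only; omega)
          rw [hDin _ hz, h3, mul_zero, zero_add]
          rw [h1] at h2
          rw [← h2]
          simp [nextPoint]
        · rw [hDout _ hz]
          exact mul_nonneg (by linarith) (hD0 _)
      have pow : ∀ (m : ℕ) (t : ℤ), max T₁ T₂ ≤ t → D (x, t) ≤ (1 - p) ^ m := by
        intro m
        induction m with
        | zero => intro t _; simpa using hD1 _
        | succ m ihm =>
          intro t ht
          rw [pow_succ']
          exact (step t ht).trans (mul_le_mul_of_nonneg_left (ihm _ (by omega)) (by linarith))
      refine le_antisymm ?_ (hD0 _)
      exact ge_of_tendsto' (tendsto_pow_atTop_nhds_zero_of_lt_one (by linarith) (by linarith))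
        fun m => pow m t ht
  -- Backward induction in time: both steps lead one time unit closer to the late regime.
  have early : ∀ (n : ℕ) (x t : ℤ), max T₁ T₂ - n ≤ t → D (x, t) = 0 := by
    intro n
    induction n with
    | zero =>
      intro x t ht
      exact late (M - x + 1).toNat x t (by omega) (by simpa using ht)
    | succ n ih =>
      intro x t ht
      by_cases hz : (x, t) ∈ L
      · have h1 : ∀ b, D (nextPoint (x, t) b) = 0 := fun b =>
          ih _ _ (by push_cast at ht; simp only; omega)
        rw [hDin _ hz, h1, h1]
        simp
      · exact hDout _ hz
  have h0 : D z = 0 := early (max T₁ T₂ - z.2).toNat z.1 z.2 (by omega)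
  have h1 : (∑' l, exitWeight p S L z l).toReal = 1 := by
    simp only [D] at h0
    linarith
  rwa [ENNReal.toReal_eq_one_iff] at h1

end exit

/-! ### Weights of paths -/

section weights
variable {N : ℕ} {B : Set (ℤ × ℤ)} {p : ℝ}

lemma mem_precedingPath {c₀ c : Config N} {pos : Fin N → ℤ → ℤ} {i : Fin N} {y s : ℤ} :
    (y, s) ∈ precedingPath c₀ c pos i ↔
      ∃ j : Fin N, j.val + 1 = i.val ∧ (c₀ j).2 ≤ s ∧ s ≤ (c j).2 ∧ y = pos j s := Iff.rfl

/-- The preceding path matters only through the jump target, so restricting that path is harmless if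
it leaves this one incidence unchanged. -/
lemma elemWeight_congr {S S' : Set (ℤ × ℤ)} {x t : ℤ} (b : ℤ × ℤ)
    (h : (x + 1, t + 1) ∈ S ↔ (x + 1, t + 1) ∈ S') :
    elemWeight p S (x, t) b = elemWeight p S' (x, t) b := by
  unfold elemWeight
  by_cases hS : (x + 1, t + 1) ∈ S
  · simp [hS, h.1 hS]
  · simp [hS, mt h.2 hS]

lemma step_of_elemWeight_ne_zero {S : Set (ℤ × ℤ)} {x y t : ℤ}
    (h : elemWeight p S (x, t) (y, t + 1) ≠ 0) :
    y = x ∨ y = x + 1 ∧ (x + 1, t + 1) ∉ S := by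
  by_contra! hc
  apply h
  unfold elemWeight
  by_cases hy : y = x + 1
  · simp [hy, hc.2 hy]
  · simp [hy, hc.1]

lemma pathWeight_nonneg (hp0 : 0 < p) (hp1 : p < 1) (c₀ c : Config N) (pos : Fin N → ℤ → ℤ) :
    0 ≤ pathWeight p c₀ c pos :=
  Finset.prod_nonneg fun _ _ => Finset.prod_nonneg fun _ _ => elemWeight_nonneg hp0 hp1 _ _ _

lemma pathWeight_congr {c₀ c d₀ d : Config N} {pos pos' : Fin N → ℤ → ℤ}
    (h0 : ∀ i, (c₀ i).2 = (d₀ i).2) (h1 : ∀ i, (c i).2 = (d i).2)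
    (h : ∀ i s, (c₀ i).2 ≤ s → s ≤ (c i).2 → pos i s = pos' i s) :
    pathWeight p c₀ c pos = pathWeight p d₀ d pos' := by
  unfold pathWeight
  refine Finset.prod_congr rfl fun i _ => ?_
  rw [← h0, ← h1]
  refine Finset.prod_congr rfl fun s hs => ?_
  rw [Finset.mem_Ico] at hs
  rw [h i s hs.1 hs.2.le, h i (s + 1) (by omega) (by omega)]
  refine elemWeight_congr _ ?_
  rw [mem_precedingPath, mem_precedingPath]
  refine exists_congr fun j => and_congr_right fun _ => ?_
  rw [← h0, ← h1]
  constructor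
  · rintro ⟨h2, h3, h4⟩
    exact ⟨h2, h3, h4.trans (h _ _ h2 h3)⟩
  · rintro ⟨h2, h3, h4⟩
    exact ⟨h2, h3, h4.trans (h _ _ h2 h3).symm⟩

lemma pathWeight_eq_one {c₀ c : Config N} (h : ∀ i, (c i).2 ≤ (c₀ i).2)
    (pos : Fin N → ℤ → ℤ) : pathWeight p c₀ c pos = 1 := by
  simp [pathWeight, Finset.Ico_eq_empty_of_le (h _)]

lemma step_of_pathWeight_ne_zero {c₀ c : Config N} {pos : Fin N → ℤ → ℤ}
    (h : pathWeight p c₀ c pos ≠ 0) {i : Fin N} {s : ℤ} (h0 : (c₀ i).2 ≤ s) (h1 : s < (c i).2) :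
    pos i (s + 1) = pos i s ∨
      pos i (s + 1) = pos i s + 1 ∧ (pos i s + 1, s + 1) ∉ precedingPath c₀ c pos i := by
  have h2 := Finset.prod_ne_zero_iff.1 h i (Finset.mem_univ _)
  exact step_of_elemWeight_ne_zero (Finset.prod_ne_zero_iff.1 h2 s (Finset.mem_Ico.2 ⟨h0, h1⟩))

/-- Every particle stays or jumps to the right, at every time. -/
def IsWalk (pos : Fin N → ℤ → ℤ) : Prop :=
  ∀ i s, pos i (s + 1) = pos i s ∨ pos i (s + 1) = pos i s + 1

lemma IsWalk.monotone {pos : Fin N → ℤ → ℤ} (h : IsWalk pos) (i : Fin N) : Monotone (pos i) :=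
  monotone_int_of_le_succ fun s => by rcases h i s with h | h <;> omega

lemma NPath.isWalk {c₀ c : Config N} (π : NPath c₀ c) (h : pathWeight p c₀ c π.pos ≠ 0) :
    IsWalk π.pos := by
  intro i s
  rcases lt_or_ge s (c₀ i).2 with h0 | h0
  · left
    rw [π.pos_start i s h0.le, π.pos_start i (s + 1) (by omega)]
  · rcases lt_or_ge s (c i).2 with h1 | h1
    · exact (step_of_pathWeight_ne_zero h h0 h1).imp id And.left
    · left
      rw [π.pos_end i s h1, π.pos_end i (s + 1) (by omega)]

lemma NPath.pos_start' {c₀ c : Config N} (π : NPath c₀ c) (i : Fin N) :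
    π.pos i (c₀ i).2 = (c₀ i).1 := π.pos_start i _ le_rfl

lemma NPath.pos_end' {c₀ c : Config N} (π : NPath c₀ c) (i : Fin N) :
    π.pos i (c i).2 = (c i).1 := π.pos_end i _ le_rfl

lemma NPath.ext {c₀ c : Config N} {π ρ : NPath c₀ c} (h : π.pos = ρ.pos) : π = ρ := by
  cases π
  cases ρ
  cases h
  rfl

/-- Exclusion: a particle stays to the left of the preceding one. -/
lemma NPath.pos_lt {c₀ c : Config N} (hc₀ : Admissible c₀) (π : NPath c₀ c)
    (h : pathWeight p c₀ c π.pos ≠ 0) {i j : Fin N} (hj : j.val + 1 = i.val) {s : ℤ}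
    (h0 : (c₀ i).2 ≤ s) (h1 : s ≤ (c j).2) : π.pos i s < π.pos j s := by
  have hji : j < i := Fin.lt_def.2 (by omega)
  have hm := (π.isWalk h).monotone
  have ht : (c₀ j).2 ≤ (c₀ i).2 := hc₀.2 hji.le
  induction s, h0 using Int.leInduction with
  | base =>
    rw [π.pos_start']
    refine lt_of_lt_of_le (hc₀.1 hji) ?_
    simp only
    rw [← π.pos_start']
    exact hm j ht
  | succ s h0 ih =>
    have ih := ih (by omega)
    have hjm : π.pos j s ≤ π.pos j (s + 1) := hm j (by omega)
    rcases lt_or_ge s (c i).2 with h2 | h2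
    · rcases step_of_pathWeight_ne_zero h h0 h2 with h3 | ⟨h3, h4⟩
      · omega
      -- A jump onto the predecessor's new position has weight zero.
      · have : π.pos i s + 1 ≠ π.pos j (s + 1) := fun h5 =>
          h4 (mem_precedingPath.2 ⟨j, hj, by omega, h1, h5⟩)
        omega
    · rw [π.pos_end i (s + 1) (by omega), ← π.pos_end i s h2]
      omega

/-! ### Leaving the domains -/

lemma prod_Ico_split {f : ℤ → ℝ} {a b c : ℤ} (h0 : a ≤ b) (h1 : b < c) :
    ∏ s ∈ Finset.Ico a c, f s =
      (∏ s ∈ Finset.Ico a b, f s) * (∏ s ∈ Finset.Ico b (b + 1), f s) *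
        ∏ s ∈ Finset.Ico (b + 1) c, f s := by
  rw [← Finset.prod_union (Finset.Ico_disjoint_Ico_consecutive _ _ _),
    Finset.Ico_union_Ico_eq_Ico h0 (by omega),
    ← Finset.prod_union (Finset.Ico_disjoint_Ico_consecutive _ _ _),
    Finset.Ico_union_Ico_eq_Ico (by omega) (by omega)]

/-- The weight of an `N`-path factorizes at the steps by which the particles leave their
domains. -/
lemma pathWeight_split {c₀ c c' c'' : Config N} {pos : Fin N → ℤ → ℤ}
    (hm : ∀ i, Monotone (pos i)) (h0 : ∀ i, (c₀ i).2 ≤ (c' i).2) (h1 : ∀ i, (c' i).2 < (c i).2)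
    (h2 : ∀ i, (c'' i).2 = (c' i).2 + 1)
    (hin : ∀ i, (pos i (c' i).2, (c' i).2) ∈ domain N B i)
    (hout : ∀ i, (pos i ((c' i).2 + 1), (c' i).2 + 1) ∉ domain N B i)
    (ht : ∀ i j : Fin N, j.val + 1 = i.val → (c' j).2 ≤ (c' i).2) :
    pathWeight p c₀ c pos =
      pathWeight p c₀ c' pos * pathWeight p c' c'' pos * pathWeight p c'' c pos := by
  unfold pathWeight
  rw [← Finset.prod_mul_distrib, ← Finset.prod_mul_distrib]
  refine Finset.prod_congr rfl fun i _ => ?_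
  rw [prod_Ico_split (h0 i) (h1 i), h2]
  have houtj : ∀ j s, (c' j).2 < s → (pos j s, s) ∉ domain N B j := fun j s hs h =>
    hout j (domain_of_le h (hm j (by omega)) (by omega))
  congr 1
  · congr 1
    · refine Finset.prod_congr rfl fun s hs => elemWeight_congr _ ?_
      rw [Finset.mem_Ico] at hs
      rw [mem_precedingPath, mem_precedingPath]
      refine exists_congr fun j => and_congr_right fun hj => and_congr_right fun hs0 =>
        and_congr_left fun hx => ?_
      have := h1 j
      refine ⟨fun _ => ?_, fun _ => by omega⟩
      -- Otherwise the jump target is a point of the predecessor's path after its exit, yet it lies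
      -- in the predecessor's domain, because the particle is still in its own domain at time `s +
      -- 1`.
      by_contra hs1
      apply houtj j (s + 1) (by omega)
      rw [← hx, ← mem_domain_next hj]
      exact domain_of_le (hin i) (hm i hs.2.le) (by omega)
    · refine Finset.prod_congr rfl fun s hs => elemWeight_congr _ ?_
      rw [Finset.mem_Ico] at hs
      obtain rfl : s = (c' i).2 := by omega
      rw [mem_precedingPath, mem_precedingPath]
      refine exists_congr fun j => and_congr_right fun hj => ?_
      have hij := ht i j hj
      have := h0 j
      have := h1 j
      rw [h2]
      refine ⟨fun ⟨_, _, hx⟩ => ⟨by omega, ?_, hx⟩, fun ⟨_, _, hx⟩ => ⟨by omega, by omega, hx⟩⟩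
      -- If the predecessor had left strictly earlier, its position at time `(c' i).2` would be at
      -- most the jump target's site, hence still inside its domain.
      by_contra hs1
      apply houtj j (c' i).2 (by omega)
      have h3 := (mem_domain_next hj).1 (hin i)
      exact domain_of_le h3 (by rw [hx]; exact hm j (by omega)) le_rfl
  · refine Finset.prod_congr rfl fun s hs => elemWeight_congr _ ?_
    rw [Finset.mem_Ico] at hs
    rw [mem_precedingPath, mem_precedingPath]
    refine exists_congr fun j => and_congr_right fun hj => and_congr_left fun _ => ?_
    have hij := ht i j hj
    have := h0 j
    rw [h2]
    exact ⟨fun _ => by omega, fun _ => by omega⟩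

lemma admissible_of_next {c : Config N}
    (h : ∀ i j : Fin N, j.val + 1 = i.val → (c i).1 < (c j).1 ∧ (c j).2 ≤ (c i).2) :
    Admissible c := by
  rcases N with _ | n
  · exact ⟨fun i => i.elim0, fun i => i.elim0⟩
  · exact ⟨Fin.strictAnti_iff_succ_lt.2 fun i => (h _ _ (by simp)).1,
      Fin.monotone_iff_le_succ.2 fun i => (h _ _ (by simp)).2⟩

/-- The last points in the domains form an admissible configuration. -/
lemma NPath.admissible_exit {c₀ c : Config N} (hc₀ : Admissible c₀) (π : NPath c₀ c)
    (h : pathWeight p c₀ c π.pos ≠ 0) {t : Fin N → ℤ} (h0 : ∀ i, (c₀ i).2 ≤ t i)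
    (h1 : ∀ i, t i < (c i).2) (hin : ∀ i, (π.pos i (t i), t i) ∈ domain N B i)
    (hout : ∀ i, (π.pos i (t i + 1), t i + 1) ∉ domain N B i) :
    Admissible fun i => (π.pos i (t i), t i) := by
  have hw := π.isWalk h
  have hm := hw.monotone
  refine admissible_of_next fun i j hj => ?_
  have hij : t j ≤ t i := by
    -- While the predecessor is still inside, a particle strictly to its left is inside its own
    -- shifted domain, so it cannot leave first.
    by_contra hlt
    have h2 : π.pos i (t i + 1) < π.pos j (t i + 1) :=
      π.pos_lt hc₀ h hj (by have := h0 i; omega) (by have := h1 j; omega)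
    apply hout i
    rw [mem_domain_next hj]
    refine domain_of_le (hin j) (le_trans (by omega) (hm j ?_ : π.pos j (t i + 1) ≤ _)) ?_ <;> omega
  refine ⟨?_, hij⟩
  simp only
  rcases hij.eq_or_lt with heq | hlt
  · rw [heq]
    exact π.pos_lt hc₀ h hj (h0 i) (by have := h1 j; omega)
  -- The predecessor leaves earlier; were its last inside site not further right, its next point
  -- would be at most the right neighbour of `(π.pos i (t i), t i)`, which is in its domain.
  · by_contra hge
    apply hout j
    refine domain_of_le ((mem_domain_next hj).1 (hin i)) ?_ (by omega)
    rcases hw j (t j) with h | h <;> omega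

lemma exit_unique {i : Fin N} {f : ℤ → ℤ} (hf : Monotone f) {s t : ℤ}
    (hs : (f s, s) ∈ domain N B i) (hs' : (f (s + 1), s + 1) ∉ domain N B i)
    (ht : (f t, t) ∈ domain N B i) (ht' : (f (t + 1), t + 1) ∉ domain N B i) : s = t := by
  by_contra hne
  rcases lt_or_gt_of_ne hne with h | h
  · exact hs' (domain_of_le ht (hf (by omega)) (by omega))
  · exact ht' (domain_of_le hs (hf (by omega)) (by omega))

lemma exists_exit {D : Set (ℤ × ℤ)} {f : ℤ → ℤ} {a b : ℤ} (hab : a ≤ b) (ha : (f a, a) ∈ D)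
    (hb : (f b, b) ∉ D) :
    ∃ t, a ≤ t ∧ t < b ∧ (f t, t) ∈ D ∧ (f (t + 1), t + 1) ∉ D := by
  induction b, hab using Int.leInduction with
  | base => exact absurd ha hb
  | succ b hab ih =>
    by_cases h : (f b, b) ∈ D
    · exact ⟨b, hab, by omega, h, hb⟩
    · obtain ⟨t, h1, h2, h3⟩ := ih h
      exact ⟨t, h1, by omega, h3⟩

/-- The step by which a walk leaves a domain starts on the boundary. -/
lemma mem_NBoundary_of_exit (hB : IsBoundary B) {pos : Fin N → ℤ → ℤ} (hw : IsWalk pos)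
    {i : Fin N} {t : ℤ} (hin : (pos i t, t) ∈ domain N B i)
    (hout : (pos i (t + 1), t + 1) ∉ domain N B i) : (pos i t, t) ∈ NBoundary N B i := by
  refine (mem_NBoundary hB).2 ⟨hin, fun h => hout (domain_of_le h ?_ le_rfl)⟩
  rcases hw i t with h | h <;> simp only [h] <;> omega

/-! ### Concatenation -/

/-- The concatenation of two `N`-paths and the single steps between them. -/
def NPath.glue {c₀ c' c'' c : Config N} (h : ∀ i, (c'' i).2 = (c' i).2 + 1) (π : NPath c₀ c')
    (ρ : NPath c'' c) : NPath c₀ c where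
  pos i s := if s ≤ (c' i).2 then π.pos i s else ρ.pos i s
  time_le i := by
    have := π.time_le i
    have := ρ.time_le i
    have := h i
    omega
  pos_start i s hs := by
    rw [if_pos (hs.trans (π.time_le i)), π.pos_start i s hs]
  pos_end i s hs := by
    have := ρ.time_le i
    have := h i
    rw [if_neg (by omega), ρ.pos_end i s hs]

lemma glue_pos_of_le {c₀ c' c'' c : Config N} (h : ∀ i, (c'' i).2 = (c' i).2 + 1)
    (π : NPath c₀ c') (ρ : NPath c'' c) {i : Fin N} {s : ℤ} (hs : s ≤ (c' i).2) :
    (π.glue h ρ).pos i s = π.pos i s := if_pos hs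

lemma glue_pos_of_lt {c₀ c' c'' c : Config N} (h : ∀ i, (c'' i).2 = (c' i).2 + 1)
    (π : NPath c₀ c') (ρ : NPath c'' c) {i : Fin N} {s : ℤ} (hs : (c' i).2 < s) :
    (π.glue h ρ).pos i s = ρ.pos i s := if_neg (not_le.2 hs)

lemma glue_isWalk {c₀ c' c'' c : Config N} (h : ∀ i, (c'' i).2 = (c' i).2 + 1) (π : NPath c₀ c')
    (ρ : NPath c'' c) (hπ : pathWeight p c₀ c' π.pos ≠ 0) (hρ : pathWeight p c'' c ρ.pos ≠ 0)
    (hs : stepWeight p c' c'' ≠ 0) : IsWalk (π.glue h ρ).pos := by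
  intro i s
  rcases lt_trichotomy s (c' i).2 with h1 | rfl | h1
  · rw [glue_pos_of_le h π ρ (by omega), glue_pos_of_le h π ρ h1.le]
    exact π.isWalk hπ i s
  · rw [glue_pos_of_le h π ρ le_rfl, glue_pos_of_lt h π ρ (lt_add_one _), π.pos_end', ← h i, ρ.pos_start']
    have := step_of_pathWeight_ne_zero hs (i := i) le_rfl (by rw [h]; omega)
    simpa using this.imp id And.left
  · rw [glue_pos_of_lt h π ρ (by omega), glue_pos_of_lt h π ρ h1]
    exact ρ.isWalk hρ i s

section glue
variable {c₀ c' c'' c : Config N} (h : ∀ i, (c'' i).2 = (c' i).2 + 1) (π : NPath c₀ c')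
  (ρ : NPath c'' c)

lemma glue_pos_last (i : Fin N) : (π.glue h ρ).pos i (c' i).2 = (c' i).1 :=
  (glue_pos_of_le h π ρ le_rfl).trans (π.pos_end' i)

lemma glue_pos_next (i : Fin N) : (π.glue h ρ).pos i ((c' i).2 + 1) = (c'' i).1 := by
  refine (glue_pos_of_lt h π ρ (by omega)).trans ?_
  rw [← h, ρ.pos_start']

lemma pathWeight_glue_left :
    pathWeight p c₀ c' (π.glue h ρ).pos = pathWeight p c₀ c' π.pos :=
  pathWeight_congr (fun _ => rfl) (fun _ => rfl) fun _ _ _ hs => glue_pos_of_le h π ρ hs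

lemma pathWeight_glue_right :
    pathWeight p c'' c (π.glue h ρ).pos = pathWeight p c'' c ρ.pos :=
  pathWeight_congr (fun _ => rfl) (fun _ => rfl) fun i _ hs _ =>
    glue_pos_of_lt h π ρ (by have := h i; omega)

lemma pathWeight_glue_mid : pathWeight p c' c'' (π.glue h ρ).pos = stepWeight p c' c'' := by
  refine pathWeight_congr (fun _ => rfl) (fun _ => rfl) fun i s hs hs' => ?_
  rcases hs.eq_or_lt with rfl | hlt
  · rw [glue_pos_last, if_pos le_rfl]
  · obtain rfl : s = (c' i).2 + 1 := by have := h i; omega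
    rw [glue_pos_next, if_neg (by omega)]

/-- Nonzero factors make the glued positions a walk, which supplies the monotonicity needed to
factorize the weight. -/
lemma pathWeight_glue (hadm : Admissible c') (hin : ∀ i, c' i ∈ domain N B i)
    (hout : ∀ i, c'' i ∉ domain N B i) (hπ : pathWeight p c₀ c' π.pos ≠ 0)
    (hρ : pathWeight p c'' c ρ.pos ≠ 0) (hs : stepWeight p c' c'' ≠ 0) :
    pathWeight p c₀ c (π.glue h ρ).pos =
      pathWeight p c₀ c' π.pos * stepWeight p c' c'' * pathWeight p c'' c ρ.pos := by
  rw [pathWeight_split (B := B) (c' := c') (c'' := c'')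
    (glue_isWalk h π ρ hπ hρ hs).monotone π.time_le
    (fun i => by have := ρ.time_le i; have := h i; omega) h
    (fun i => by rw [glue_pos_last]; exact hin i)
    (fun i => by rw [glue_pos_next, ← h]; exact hout i)
    (fun i j hj => hadm.2 (Fin.le_def.2 (by omega))),
    pathWeight_glue_left, pathWeight_glue_mid, pathWeight_glue_right]

end glue

end weights

section sums
variable {N : ℕ} {B : Set (ℤ × ℤ)} {p : ℝ}

/-! ### Summation over the exit points -/

/-- Splits equality of dependent tuples into equalities of raw data; `β` is a final path in one use
and `Unit` in the other. -/
lemma sigma_exit_ext {c₀ : Config N} {β : ((c' : BoundaryConfig N B) × ExitTarget B c'.1) → Type*}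
    {x y : (e : (c' : BoundaryConfig N B) × ExitTarget B c'.1) × NPath c₀ e.1.1 × β e}
    (h1 : x.1.1.1 = y.1.1.1) (h2 : x.1.2.1 = y.1.2.1) (h3 : x.2.1.pos = y.2.1.pos)
    (h4 : ∀ h : x.1 = y.1, h ▸ x.2.2 = y.2.2) : x = y := by
  obtain ⟨⟨⟨c, hc⟩, ⟨d, hd⟩⟩, π, a⟩ := x
  obtain ⟨⟨⟨c', hc'⟩, ⟨d', hd'⟩⟩, π', a'⟩ := y
  simp only at h1 h2 h3
  subst h1
  subst h2
  obtain rfl := NPath.ext h3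
  have h5 : a = a' := h4 rfl
  rw [h5]

lemma ExitTarget.time {c' : Config N} (d : ExitTarget B c') (i : Fin N) :
    (d.1 i).2 = (c' i).2 + 1 := (d.2 i).1

lemma BoundaryConfig.mem_domain (hB : IsBoundary B) (c : BoundaryConfig N B) (i : Fin N) :
    c.1 i ∈ domain N B i := ((mem_NBoundary hB).1 (c.2.2 i)).1

/-- The initial piece of an `N`-path. -/
def NPath.left {c₀ c : Config N} (π : NPath c₀ c) (c' : Config N) (h0 : ∀ i, (c₀ i).2 ≤ (c' i).2)
    (hc' : ∀ i, π.pos i (c' i).2 = (c' i).1) : NPath c₀ c' where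
  pos i s := π.pos i (min s (c' i).2)
  time_le := h0
  pos_start i s hs := π.pos_start i _ ((min_le_left _ _).trans hs)
  pos_end i s hs := by rw [min_eq_right hs, hc']

/-- The final piece of an `N`-path. -/
def NPath.right {c₀ c : Config N} (π : NPath c₀ c) (c' : Config N) (h0 : ∀ i, (c' i).2 ≤ (c i).2)
    (hc' : ∀ i, π.pos i (c' i).2 = (c' i).1) : NPath c' c where
  pos i s := π.pos i (max s (c' i).2)
  time_le := h0
  pos_start i s hs := by rw [max_eq_right hs, hc']
  pos_end i s hs := π.pos_end i _ (hs.trans (le_max_left _ _))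

lemma NPath.exists_glue (hB : IsBoundary B) {c₀ c : Config N} (hc₀ : Admissible c₀)
    (π : NPath c₀ c) (h : pathWeight p c₀ c π.pos ≠ 0) {t : Fin N → ℤ}
    (h0 : ∀ i, (c₀ i).2 ≤ t i)
    (h1 : ∀ i, t i < (c i).2) (hin : ∀ i, (π.pos i (t i), t i) ∈ domain N B i)
    (hout : ∀ i, (π.pos i (t i + 1), t i + 1) ∉ domain N B i) :
    ∃ (c' : BoundaryConfig N B) (c'' : ExitTarget B c'.1) (ρ : NPath c₀ c'.1) (σ : NPath c''.1 c),
      (∀ i, c''.1 i = (π.pos i (t i + 1), t i + 1)) ∧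
      ρ.glue c''.time σ = π ∧ pathWeight p c₀ c'.1 ρ.pos ≠ 0 ∧
      stepWeight p c'.1 c''.1 ≠ 0 ∧ pathWeight p c''.1 c σ.pos ≠ 0 := by
  have hw := π.isWalk h
  have hadm := π.admissible_exit hc₀ h h0 h1 hin hout
  let c' : BoundaryConfig N B := ⟨fun i => (π.pos i (t i), t i), hadm,
    fun i => mem_NBoundary_of_exit hB hw (hin i) (hout i)⟩
  let c'' : ExitTarget B c'.1 := ⟨fun i => (π.pos i (t i + 1), t i + 1),
    fun i => ⟨rfl, hout i⟩⟩
  let ρ : NPath c₀ c'.1 := π.left c'.1 h0 fun _ => rfl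
  let σ : NPath c''.1 c := π.right c''.1 h1 fun _ => rfl
  have hglue : ρ.glue c''.time σ = π := by
    refine NPath.ext (funext fun i => funext fun s => ?_)
    rcases le_or_gt s (t i) with hs | hs
    · rw [glue_pos_of_le _ _ _ hs]
      simp [ρ, NPath.left, c', hs]
    · rw [glue_pos_of_lt _ _ _ hs]
      simp only [σ, NPath.right, c'']
      rw [max_eq_left (by omega)]
  have hsplit := pathWeight_split (p := p) (c₀ := c₀) (c := c) (c' := c'.1) (c'' := c''.1)
    hw.monotone h0 h1 (fun _ => rfl) hin hout (fun i j hj => hadm.2 (Fin.le_def.2 (by omega)))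
  rw [hsplit, ← hglue, pathWeight_glue_left, pathWeight_glue_mid, pathWeight_glue_right] at h
  exact ⟨c', c'', ρ, σ, fun _ => rfl, hglue,
    left_ne_zero_of_mul (left_ne_zero_of_mul h), right_ne_zero_of_mul (left_ne_zero_of_mul h),
    right_ne_zero_of_mul h⟩

lemma ofReal_mul_three {a b c : ℝ} (ha : 0 ≤ a) (hb : 0 ≤ b) :
    ENNReal.ofReal a * ENNReal.ofReal b * ENNReal.ofReal c = ENNReal.ofReal (a * b * c) := by
  rw [ENNReal.ofReal_mul (mul_nonneg ha hb), ENNReal.ofReal_mul ha]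

lemma ne_zero_of_ofReal {a : ℝ} (h : ENNReal.ofReal a ≠ 0) : a ≠ 0 := by
  rintro rfl
  simp at h

/-- Decomposition of the `N`-paths that end outside of the domains at their exit points. -/
lemma tsum_exit_paths (hB : IsBoundary B) (hp0 : 0 < p) (hp1 : p < 1) {c₀ c : Config N}
    (hc₀ : Admissible c₀) (hc₀B : ∀ i, c₀ i ∈ domain N B i) (hc : ∀ i, c i ∉ domain N B i) :
    ∑' π : NPath c₀ c, ENNReal.ofReal (pathWeight p c₀ c π.pos) =
    ∑' x : (e : (c' : BoundaryConfig N B) × ExitTarget B c'.1) × NPath c₀ e.1.1 × NPath e.2.1 c,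
      ENNReal.ofReal (pathWeight p c₀ x.1.1.1 x.2.1.pos) *
        ENNReal.ofReal (stepWeight p x.1.1.1 x.1.2.1) *
        ENNReal.ofReal (pathWeight p x.1.2.1 c x.2.2.pos) := by
  have hnn := pathWeight_nonneg hp0 hp1 (N := N)
  refine tsum_eq_tsum_of_ne_zero_bij
    (fun x => x.1.2.1.glue x.1.1.2.time x.1.2.2) ?_ ?_ ?_
  · rintro ⟨x, hx⟩ ⟨y, hy⟩ hxy
    simp only at hxy
    have hx1 := ne_zero_of_ofReal (left_ne_zero_of_mul (left_ne_zero_of_mul hx))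
    have hx2 := ne_zero_of_ofReal (right_ne_zero_of_mul (left_ne_zero_of_mul hx))
    have hx3 := ne_zero_of_ofReal (right_ne_zero_of_mul hx)
    have hm := (glue_isWalk x.1.2.time x.2.1 x.2.2 hx1 hx3 hx2).monotone
    -- Both triples glue to the same walk, whose exit time from each domain is unique.
    have ht : ∀ i, (x.1.1.1 i).2 = (y.1.1.1 i).2 := by
      intro i
      refine exit_unique (B := B) (i := i) (hm i) ?_ ?_ ?_ ?_
      · rw [glue_pos_last]
        exact x.1.1.mem_domain hB i
      · rw [glue_pos_next, ← x.1.2.time]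
        exact (x.1.2.2 i).2
      · rw [hxy, glue_pos_last]
        exact y.1.1.mem_domain hB i
      · rw [hxy, glue_pos_next, ← y.1.2.time]
        exact (y.1.2.2 i).2
    have h1 : x.1.1.1 = y.1.1.1 := by
      funext i
      refine Prod.ext ?_ (ht i)
      rw [← glue_pos_last x.1.2.time x.2.1 x.2.2, hxy, ht, glue_pos_last]
    have h2 : x.1.2.1 = y.1.2.1 := by
      funext i
      refine Prod.ext ?_ (by rw [x.1.2.time, y.1.2.time, ht])
      rw [← glue_pos_next x.1.2.time x.2.1 x.2.2, hxy, ht, glue_pos_next]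
    have h3 : x.2.1.pos = y.2.1.pos := by
      funext i s
      rcases le_or_gt s (x.1.1.1 i).2 with hs | hs
      · rw [← glue_pos_of_le x.1.2.time x.2.1 x.2.2 hs, hxy, glue_pos_of_le _ _ _ (by rwa [← ht])]
      · rw [x.2.1.pos_end i s hs.le, y.2.1.pos_end i s (by rw [← ht]; exact hs.le), h1]
    have h4 : x.2.2.pos = y.2.2.pos := by
      funext i s
      rcases le_or_gt s (x.1.1.1 i).2 with hs | hs
      · rw [x.2.2.pos_start i s (by rw [x.1.2.time]; omega),
          y.2.2.pos_start i s (by rw [y.1.2.time, ← ht]; omega), h2]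
      · rw [← glue_pos_of_lt x.1.2.time x.2.1 x.2.2 hs, hxy, glue_pos_of_lt _ _ _ (by rwa [← ht])]
    refine Subtype.ext (sigma_exit_ext h1 h2 h3 fun h => ?_)
    obtain ⟨e, π, ρ⟩ := x
    obtain ⟨e', π', ρ'⟩ := y
    obtain rfl : e = e' := h
    exact NPath.ext h4
  · intro π hπ
    have hW := ne_zero_of_ofReal hπ
    have hex := fun i => exists_exit (D := domain N B i) (f := π.pos i) (π.time_le i)
      (by rw [π.pos_start']; exact hc₀B i) (by rw [π.pos_end']; exact hc i)
    choose t h0 h1 hin hout using hex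
    obtain ⟨c', c'', ρ, σ, -, h, h2, h3, h4⟩ := π.exists_glue hB hc₀ hW h0 h1 hin hout
    refine ⟨⟨⟨⟨c', c''⟩, ρ, σ⟩, ?_⟩, h⟩
    rw [Function.mem_support]
    refine mul_ne_zero (mul_ne_zero ?_ ?_) ?_ <;> rw [ENNReal.ofReal_ne_zero_iff]
    · exact lt_of_le_of_ne (hnn _ _ _) h2.symm
    · exact lt_of_le_of_ne (hnn _ _ _) h3.symm
    · exact lt_of_le_of_ne (hnn _ _ _) h4.symm
  · rintro ⟨x, hx⟩
    have hx1 := ne_zero_of_ofReal (left_ne_zero_of_mul (left_ne_zero_of_mul hx))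
    have hx2 := ne_zero_of_ofReal (right_ne_zero_of_mul (left_ne_zero_of_mul hx))
    have hx3 := ne_zero_of_ofReal (right_ne_zero_of_mul hx)
    exact (congrArg ENNReal.ofReal (pathWeight_glue (B := B) _ _ _ x.1.1.2.1
      (x.1.1.mem_domain hB) (fun i => (x.1.2.2 i).2) hx1 hx3 hx2)).trans
      (ofReal_mul_three (hnn _ _ _) (hnn _ _ _)).symm

/-- The `N`-path of a single point. -/
def NPath.refl (c : Config N) : NPath c c where
  pos i _ := (c i).1
  time_le _ := le_rfl
  pos_start _ _ _ := rfl
  pos_end _ _ _ := rfl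

open Classical in
/-- The weight of an `N`-path, provided that every particle leaves its domain by its last
step. -/
noncomputable def exitPathWeight (p : ℝ) (B : Set (ℤ × ℤ)) {c₀ : Config N}
    (x : (c : Config N) × NPath c₀ c) : ℝ≥0∞ :=
  if ∀ i, (∀ s, (c₀ i).2 ≤ s → s < (x.1 i).2 → (x.2.pos i s, s) ∈ domain N B i) ∧
      x.1 i ∉ domain N B i then
    ENNReal.ofReal (pathWeight p c₀ x.1 x.2.pos) else 0

/-- A stopped `N`-path is an `N`-path to the boundary followed by one exit step, that is, a gluing
with a one-point final piece. -/
lemma tsum_exitPathWeight_eq (hB : IsBoundary B) (hp0 : 0 < p) (hp1 : p < 1) {c₀ : Config N}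
    (hc₀ : Admissible c₀) (hc₀B : ∀ i, c₀ i ∈ domain N B i) :
    ∑' x : (c : Config N) × NPath c₀ c, exitPathWeight p B x =
    ∑' x : (e : (c' : BoundaryConfig N B) × ExitTarget B c'.1) × NPath c₀ e.1.1 × Unit,
      ENNReal.ofReal (pathWeight p c₀ x.1.1.1 x.2.1.pos) *
        ENNReal.ofReal (stepWeight p x.1.1.1 x.1.2.1) := by
  have hnn := pathWeight_nonneg hp0 hp1 (N := N)
  refine tsum_eq_tsum_of_ne_zero_bij
    (fun x => ⟨x.1.1.2.1, x.1.2.1.glue x.1.1.2.time (NPath.refl _)⟩) ?_ ?_ ?_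
  · rintro ⟨x, hx⟩ ⟨y, hy⟩ hxy
    have h2 : x.1.2.1 = y.1.2.1 := congrArg Sigma.fst hxy
    have hpos : (x.2.1.glue x.1.2.time (NPath.refl _)).pos =
        (y.2.1.glue y.1.2.time (NPath.refl _)).pos :=
      congrArg (fun z : (c : Config N) × NPath c₀ c => z.2.pos) hxy
    have ht : ∀ i, (x.1.1.1 i).2 = (y.1.1.1 i).2 := by
      intro i
      have h3 := x.1.2.time i
      rw [h2, y.1.2.time i] at h3
      omega
    have h1 : x.1.1.1 = y.1.1.1 := by
      funext i
      refine Prod.ext ?_ (ht i)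
      rw [← glue_pos_last x.1.2.time x.2.1 (NPath.refl _), hpos, ht, glue_pos_last]
    have h3 : x.2.1.pos = y.2.1.pos := by
      funext i s
      rcases le_or_gt s (x.1.1.1 i).2 with hs | hs
      · rw [← glue_pos_of_le x.1.2.time x.2.1 (NPath.refl _) hs, hpos,
          glue_pos_of_le _ _ _ (by rwa [← ht])]
      · rw [x.2.1.pos_end i s hs.le, y.2.1.pos_end i s (by rw [← ht]; exact hs.le), h1]
    exact Subtype.ext (sigma_exit_ext h1 h2 h3 fun _ => rfl)
  · classical
    rintro ⟨c, π⟩ hπ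
    rw [Function.mem_support, exitPathWeight, ite_ne_right_iff] at hπ
    obtain ⟨hex, hW⟩ := hπ
    have hW := ne_zero_of_ofReal hW
    simp only at hex hW
    -- A path without steps would end at its starting point, which is inside; so there is a last
    -- step, and it starts at time `(c i).2 - 1`.
    have hlt : ∀ i, (c₀ i).2 < (c i).2 := by
      intro i
      refine lt_of_le_of_ne (π.time_le i) fun heq => (hex i).2 ?_
      have : c i = c₀ i := by
        refine Prod.ext ?_ heq.symm
        rw [← π.pos_start', heq, π.pos_end']
      rw [this]
      exact hc₀B i
    obtain ⟨c', c'', ρ, σ, hc'', h, h2, h3, h4⟩ :=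
      π.exists_glue (t := fun i => (c i).2 - 1) hB hc₀ hW (fun i => by have := hlt i; omega)
      (fun i => by omega) (fun i => (hex i).1 _ (by have := hlt i; omega) (by omega))
      (fun i => by
        rw [sub_add_cancel, π.pos_end']
        exact (hex i).2)
    have hcc : c = c''.1 := by
      funext i
      rw [hc'', sub_add_cancel, π.pos_end']
    refine ⟨⟨⟨⟨c', c''⟩, ρ, ()⟩, ?_⟩, ?_⟩
    · rw [Function.mem_support]
      refine mul_ne_zero ?_ ?_ <;> rw [ENNReal.ofReal_ne_zero_iff]
      · exact lt_of_le_of_ne (hnn _ _ _) h2.symm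
      · exact lt_of_le_of_ne (hnn _ _ _) h3.symm
    · subst hcc
      have hσ : σ = NPath.refl _ := by
        refine NPath.ext (funext fun i => funext fun s => ?_)
        rcases le_total s (c''.1 i).2 with hs | hs
        · exact σ.pos_start i s hs
        · exact σ.pos_end i s hs
      rw [← h, hσ]
  · rintro ⟨x, hx⟩
    have hx1 := ne_zero_of_ofReal (left_ne_zero_of_mul hx)
    have hx2 := ne_zero_of_ofReal (right_ne_zero_of_mul hx)
    have h1 : pathWeight p x.1.2.1 x.1.2.1 (NPath.refl x.1.2.1).pos = 1 :=
      pathWeight_eq_one (fun _ => le_rfl) _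
    have h10 : pathWeight p x.1.2.1 x.1.2.1 (NPath.refl x.1.2.1).pos ≠ 0 := by
      rw [h1]
      exact one_ne_zero
    have hm := (glue_isWalk x.1.2.time x.2.1 (NPath.refl _) hx1 h10 hx2).monotone
    rw [exitPathWeight, if_pos]
    · rw [← ENNReal.ofReal_mul (hnn _ _ _), pathWeight_glue (B := B) _ _ _ x.1.1.2.1
        (x.1.1.mem_domain hB) (fun i => (x.1.2.2 i).2) hx1 h10 hx2, h1, mul_one]
    · refine fun i => ⟨fun s _ hs => ?_, (x.1.2.2 i).2⟩
      have hs : s ≤ (x.1.1.1 i).2 := by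
        have := x.1.2.time i
        simp only at hs
        omega
      refine domain_of_le (x.1.1.mem_domain hB i) ?_ hs
      rw [← glue_pos_last x.1.2.time x.2.1 (NPath.refl _) i]
      exact hm i hs

/-! ### Words -/

lemma walk_of_le {z : ℤ × ℤ} {l : List Bool} {s : ℤ} (h : s ≤ z.2) : walk z l s = z.1 := by
  cases l with
  | nil => rfl
  | cons b l => simp [walk, h]

lemma walk_cons_of_lt {z : ℤ × ℤ} {b : Bool} {l : List Bool} {s : ℤ} (h : z.2 < s) :
    walk z (b :: l) s = walk (nextPoint z b) l s := by
  simp [walk, not_le.2 h]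

lemma walk_cons_next (z : ℤ × ℤ) (b : Bool) (l : List Bool) :
    walk z (b :: l) (z.2 + 1) = (nextPoint z b).1 := by
  rw [walk_cons_of_lt (by omega), walk_of_le]
  exact le_rfl

lemma walk_of_ge {z : ℤ × ℤ} {l : List Bool} {s : ℤ} (h : z.2 + l.length ≤ s) :
    walk z l s = walk z l (z.2 + l.length) := by
  induction l generalizing z with
  | nil => rfl
  | cons b l ih =>
    have h1 : (nextPoint z b).2 + l.length = z.2 + ↑(b :: l).length := by
      simp [nextPoint]
      ring
    rw [walk_cons_of_lt, walk_cons_of_lt, ih (by rw [h1]; exact h), h1]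
    · simp
    · simp at h
      omega

/-- Equal lengths are essential: trailing waiting steps cannot be told from the constant extension.
-/
lemma walk_inj {z : ℤ × ℤ} {l l' : List Bool} (hl : l.length = l'.length)
    (h : walk z l = walk z l') : l = l' := by
  induction l generalizing z l' with
  | nil => exact (List.length_eq_zero_iff.1 hl.symm).symm
  | cons b l ih =>
    obtain _ | ⟨b', l'⟩ := l'
    · simp at hl
    have hb : b = b' := by
      have h1 := congrFun h (z.2 + 1)
      rw [walk_cons_next, walk_cons_next] at h1
      revert h1
      cases b <;> cases b' <;> simp [nextPoint]
    subst hb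
    congr 1
    refine ih (z := nextPoint z b) (by simpa using hl) (funext fun s => ?_)
    rcases le_or_gt s z.2 with hs | hs
    · rw [walk_of_le, walk_of_le] <;> simp only [nextPoint] <;> omega
    · rw [← walk_cons_of_lt hs, ← walk_cons_of_lt hs, h]

lemma exists_walk {f : ℤ → ℤ} (hf : ∀ s, f (s + 1) = f s ∨ f (s + 1) = f s + 1) :
    ∀ (n : ℕ) (z : ℤ × ℤ), f z.2 = z.1 →
      ∃ l : List Bool, l.length = n ∧ ∀ s, z.2 ≤ s → s ≤ z.2 + n → walk z l s = f s
  | 0, z, hz => ⟨[], rfl, fun s h1 h2 => by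
      obtain rfl : s = z.2 := by
        push_cast at h2
        omega
      rw [hz]
      rfl⟩
  | n + 1, z, hz => by
    have hb : ∃ b, f (z.2 + 1) = (nextPoint z b).1 := by
      rcases hf z.2 with h | h
      · exact ⟨false, by simp [nextPoint, h, hz]⟩
      · exact ⟨true, by simp [nextPoint, h, hz]⟩
    obtain ⟨b, hb⟩ := hb
    obtain ⟨l, hl, h⟩ := exists_walk hf n (nextPoint z b) hb
    refine ⟨b :: l, by simp [hl], fun s h1 h2 => ?_⟩
    rcases h1.eq_or_lt with rfl | h1
    · rw [walk_of_le le_rfl, hz]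
    · rw [walk_cons_of_lt h1]
      refine h s ?_ ?_ <;> simp only [nextPoint]
      · omega
      · push_cast at h2
        omega

-- Unfolds the recursion suited to one-step analysis into the product over times that occurs in
-- `pathWeight`.
open Classical in
lemma exitWeight_eq (hp0 : 0 < p) (hp1 : p < 1) (S L : Set (ℤ × ℤ)) (z : ℤ × ℤ) (l : List Bool) :
    exitWeight p S L z l =
      if (∀ s, z.2 ≤ s → s < z.2 + l.length → (walk z l s, s) ∈ L) ∧
        (walk z l (z.2 + l.length), z.2 + (l.length : ℤ)) ∉ L then
      ENNReal.ofReal (∏ s ∈ Finset.Ico z.2 (z.2 + l.length),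
        elemWeight p S (walk z l s, s) (walk z l (s + 1), s + 1)) else 0 := by
  induction l generalizing z with
  | nil =>
    have : ∀ s : ℤ, z.2 ≤ s → ¬ s < z.2 := fun s h => by omega
    by_cases hz : z ∈ L <;> simp +contextual [exitWeight, walk, hz, this]
  | cons b l ih =>
    have h1 : z.2 + ((b :: l).length : ℤ) = (nextPoint z b).2 + l.length := by
      simp [nextPoint]
      ring
    have h2 : z.2 < (nextPoint z b).2 + l.length := by
      simp only [nextPoint]
      omega
    rw [exitWeight, h1, ih, walk_cons_of_lt h2]
    by_cases hz : z ∈ L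
    · rw [if_pos hz, mul_ite, mul_zero]
      refine if_congr (and_congr_left fun _ => ?_) ?_ rfl
      · constructor
        · intro h s hs hs'
          rcases hs.eq_or_lt with rfl | hs
          · rwa [walk_of_le le_rfl]
          · rw [walk_cons_of_lt hs]
            exact h s (by simp only [nextPoint]; omega) hs'
        · intro h s hs hs'
          simp only [nextPoint] at hs
          rw [← walk_cons_of_lt (by omega)]
          exact h s (by omega) hs'
      · rw [← ENNReal.ofReal_mul (elemWeight_nonneg hp0 hp1 _ _ _)]
        congr 1
        rw [prod_Ico_split (le_refl z.2) h2]
        simp only [Finset.Ico_self, Finset.prod_empty, one_mul]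
        congr 1
        · have : Finset.Ico z.2 (z.2 + 1) = {z.2} := by
            ext s
            simp
            omega
          rw [this, Finset.prod_singleton, walk_of_le le_rfl, walk_cons_next]
          rfl
        · refine Finset.prod_congr rfl fun s hs => ?_
          rw [Finset.mem_Ico] at hs
          rw [walk_cons_of_lt (by omega), walk_cons_of_lt (by omega)]
    · rw [if_neg hz, if_neg]
      rintro ⟨h, -⟩
      have := h z.2 le_rfl h2
      rw [walk_of_le le_rfl] at this
      exact hz this

/-- The `N`-path that follows given words. -/
def wordsPath (c₀ : Config N) (w : Fin N → List Bool) : (c : Config N) × NPath c₀ c where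
  fst i := (walk (c₀ i) (w i) ((c₀ i).2 + (w i).length), (c₀ i).2 + (w i).length)
  snd :=
    { pos := fun i => walk (c₀ i) (w i)
      time_le := fun i => by simp
      pos_start := fun i s hs => walk_of_le hs
      pos_end := fun i s hs => walk_of_ge hs }

lemma wordsPath_injective (c₀ : Config N) : Function.Injective (wordsPath c₀) := by
  intro w w' h
  funext i
  have h1 := congrArg (fun z : (c : Config N) × NPath c₀ c => (z.1 i).2) h
  have h2 := congrArg (fun z : (c : Config N) × NPath c₀ c => z.2.pos i) h
  simp only [wordsPath] at h1 h2
  exact walk_inj (by omega) h2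

lemma prod_exitWeight (hp0 : 0 < p) (hp1 : p < 1) (c₀ : Config N) (w : Fin N → List Bool) :
    ∏ i, exitWeight p (precedingPath c₀ (wordsPath c₀ w).1 (wordsPath c₀ w).2.pos i)
      (domain N B i) (c₀ i) (w i) = exitPathWeight p B (wordsPath c₀ w) := by
  classical
  simp only [exitWeight_eq hp0 hp1]
  rw [exitPathWeight]
  split_ifs with h
  · rw [pathWeight, ENNReal.ofReal_prod_of_nonneg fun i _ =>
      Finset.prod_nonneg fun s _ => elemWeight_nonneg hp0 hp1 _ _ _]
    exact Finset.prod_congr rfl fun i _ => if_pos (h i)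
  · obtain ⟨i, hi⟩ := not_forall.1 h
    exact Finset.prod_eq_zero (Finset.mem_univ i) (if_neg hi)

lemma tsum_exitPathWeight (hB : IsBoundary B) (hp0 : 0 < p) (hp1 : p < 1) (c₀ : Config N) :
    ∑' x : (c : Config N) × NPath c₀ c, exitPathWeight p B x = 1 := by
  rw [← (wordsPath_injective c₀).tsum_eq]
  · simp only [← prod_exitWeight hp0 hp1]
    -- The invariant on obstacle sets is boundedness in time: each predecessor's path ends with its
    -- finite word.
    have key := tsum_chain (fun S : Set (ℤ × ℤ) => ∃ T : ℤ, ∀ z ∈ S, z.2 ≤ T) ⟨0, by simp⟩ N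
      (fun j l => {z | (c₀ j).2 ≤ z.2 ∧ z.2 ≤ (c₀ j).2 + l.length ∧ z.1 = walk (c₀ j) l z.2})
      (fun i S l => exitWeight p S (domain N B i) (c₀ i) l) (fun j l => ⟨_, fun z hz => hz.2.1⟩)
      fun i S hS => tsum_exitWeight S _ hp0 hp1 (domain_exists_bound hB i) hS _
    exact key
  · classical
    rintro ⟨c, π⟩ h
    rw [Function.mem_support, exitPathWeight, ite_ne_right_iff] at h
    have hw := π.isWalk (ne_zero_of_ofReal h.2)
    have hex := fun i => exists_walk (hw i) ((c i).2 - (c₀ i).2).toNat (c₀ i) (π.pos_start' i)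
    choose w hl hw using hex
    have hlen : ∀ i, (c₀ i).2 + (w i).length = (c i).2 := by
      intro i
      have := π.time_le i
      rw [hl]
      omega
    have hpos : ∀ i s, walk (c₀ i) (w i) s = π.pos i s := by
      intro i s
      rcases le_total s (c₀ i).2 with hs | hs
      · rw [walk_of_le hs, π.pos_start i s hs]
      · have hw : ∀ i s, (c₀ i).2 ≤ s → s ≤ (c i).2 → walk (c₀ i) (w i) s = π.pos i s := by
          intro i
          have := hw i
          rwa [← hl, hlen] at this
        rcases le_total s (c i).2 with hs' | hs'
        · exact hw i s hs hs'
        · rw [walk_of_ge (by rwa [hlen]), hlen, hw i _ (π.time_le i) le_rfl, π.pos_end',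
            π.pos_end i s hs']
    refine ⟨w, ?_⟩
    have hc : (wordsPath c₀ w).1 = c := by
      funext i
      refine Prod.ext ?_ (hlen i)
      simp only [wordsPath]
      rw [hlen, hpos, π.pos_end']
    refine Sigma.ext hc ?_
    subst hc
    exact heq_of_eq (NPath.ext (funext fun i => funext fun s => hpos i s))

end sums

section finite
variable {N : ℕ} {p : ℝ}

/-! ### Finiteness -/

/-- Monotonicity confines each position in the finite time window between the initial and final
sites. Without summability the real `tsum` could be the default value zero. -/
lemma finite_pathWeight_ne_zero (c₀ c : Config N) :
    (Function.support fun π : NPath c₀ c => pathWeight p c₀ c π.pos).Finite := by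
  refine Set.Finite.of_injOn
    (f := fun π (i : Fin N) (s : Set.Icc (c₀ i).2 (c i).2) => π.pos i s)
    (t := {f | ∀ i s, f i s ∈ Set.Icc (c₀ i).1 (c i).1}) ?_ ?_
    (Set.Finite.pi' fun i => Set.Finite.pi' fun s => Set.finite_Icc _ _)
  · rintro π hπ i ⟨s, hs⟩
    have hm := (π.isWalk hπ).monotone i
    refine ⟨?_, ?_⟩
    · rw [← π.pos_start']
      exact hm hs.1
    · rw [← π.pos_end']
      exact hm hs.2
  · intro π _ ρ _ h
    refine NPath.ext (funext fun i => funext fun s => ?_)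
    rcases le_total s (c₀ i).2 with h0 | h0
    · rw [π.pos_start i s h0, ρ.pos_start i s h0]
    · rcases le_total (c i).2 s with h1 | h1
      · rw [π.pos_end i s h1, ρ.pos_end i s h1]
      · exact congrFun (congrFun h i) ⟨s, h0, h1⟩

lemma finite_stepWeight_ne_zero (B : Set (ℤ × ℤ)) (c' : Config N) :
    (Function.support fun c'' : ExitTarget B c' => stepWeight p c' c''.1).Finite := by
  refine Set.Finite.of_injOn (f := fun c'' => c''.1)
    (t := {f | ∀ i, f i ∈ ({((c' i).1, (c' i).2 + 1), ((c' i).1 + 1, (c' i).2 + 1)} : Set _)})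
    ?_ Subtype.val_injective.injOn (Set.Finite.pi' fun i => Set.toFinite _)
  intro c'' h i
  have h1 := step_of_pathWeight_ne_zero (Function.mem_support.1 h) (i := i) le_rfl
    (by rw [c''.time]; omega)
  have h2 : (c''.1 i).1 = (c' i).1 ∨ (c''.1 i).1 = (c' i).1 + 1 := by
    simpa using h1.imp id And.left
  have h3 := c''.time i
  rcases h2 with h2 | h2
  · exact Or.inl (Prod.ext h2 h3)
  · exact Or.inr (Prod.ext h2 h3)

/-! ### Passage to extended nonnegative sums and the two identities -/

lemma stepWeight_nonneg (hp0 : 0 < p) (hp1 : p < 1) (c' c'' : Config N) :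
    0 ≤ stepWeight p c' c'' := pathWeight_nonneg hp0 hp1 _ _ _

lemma GGF_nonneg (hp0 : 0 < p) (hp1 : p < 1) (c c₀ : Config N) : 0 ≤ GGF p c c₀ :=
  tsum_nonneg fun _ => pathWeight_nonneg hp0 hp1 _ _ _

lemma exitProb_nonneg (hp0 : 0 < p) (hp1 : p < 1) (B : Set (ℤ × ℤ)) (c' : Config N) :
    0 ≤ exitProb p B c' :=
  tsum_nonneg fun _ => stepWeight_nonneg hp0 hp1 _ _

lemma ofReal_GGF (hp0 : 0 < p) (hp1 : p < 1) (c c₀ : Config N) :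
    ENNReal.ofReal (GGF p c c₀) = ∑' π : NPath c₀ c, ENNReal.ofReal (pathWeight p c₀ c π.pos) :=
  ENNReal.ofReal_tsum_of_nonneg (fun _ => pathWeight_nonneg hp0 hp1 _ _ _)
    (summable_of_hasFiniteSupport (finite_pathWeight_ne_zero _ _))

lemma ofReal_exitProb (hp0 : 0 < p) (hp1 : p < 1) (B : Set (ℤ × ℤ)) (c' : Config N) :
    ENNReal.ofReal (exitProb p B c') =
      ∑' c'' : ExitTarget B c', ENNReal.ofReal (stepWeight p c' c''.1) :=
  ENNReal.ofReal_tsum_of_nonneg (fun _ => stepWeight_nonneg hp0 hp1 _ _)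
    (summable_of_hasFiniteSupport (finite_stepWeight_ne_zero _ _))

/-- The total mass of the exit distribution. -/
lemma tsum_exitProb_mul_GGF {B : Set (ℤ × ℤ)} (hB : IsBoundary B) (hp0 : 0 < p) (hp1 : p < 1)
    {c₀ : Config N} (hc₀ : Admissible c₀) (hc₀B : ∀ i, c₀ i ∈ domain N B i) :
    ∑' c : BoundaryConfig N B, ENNReal.ofReal (exitProb p B c.1 * GGF p c.1 c₀) = 1 := by
  rw [← tsum_exitPathWeight hB hp0 hp1 c₀, tsum_exitPathWeight_eq hB hp0 hp1 hc₀ hc₀B,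
    ENNReal.tsum_sigma', ENNReal.tsum_sigma']
  refine tsum_congr fun c => ?_
  rw [ENNReal.ofReal_mul (exitProb_nonneg hp0 hp1 _ _), ofReal_exitProb hp0 hp1,
    ofReal_GGF hp0 hp1, ← ENNReal.tsum_mul_right]
  refine tsum_congr fun d => ?_
  rw [ENNReal.tsum_prod', ← ENNReal.tsum_mul_left]
  refine tsum_congr fun π => ?_
  rw [tsum_fintype, Finset.univ_unique, Finset.sum_singleton, mul_comm]

/-- The decomposition of the generalized Green function at the boundary. -/
lemma hasSum_GGF_exit {B : Set (ℤ × ℤ)} (hB : IsBoundary B) (hp0 : 0 < p) (hp1 : p < 1)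
    {c₀ c : Config N} (hc₀ : Admissible c₀) (hc₀B : ∀ i, c₀ i ∈ domain N B i)
    (hc : ∀ i, c i ∉ domain N B i) :
    HasSum (fun e : (c' : BoundaryConfig N B) × ExitTarget B c'.1 =>
      GGF p c e.2.1 * stepWeight p e.1.1 e.2.1 * GGF p e.1.1 c₀) (GGF p c c₀) := by
  have hnn : ∀ e : (c' : BoundaryConfig N B) × ExitTarget B c'.1,
      0 ≤ GGF p c e.2.1 * stepWeight p e.1.1 e.2.1 * GGF p e.1.1 c₀ := fun e =>
    mul_nonneg (mul_nonneg (GGF_nonneg hp0 hp1 _ _) (stepWeight_nonneg hp0 hp1 _ _))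
      (GGF_nonneg hp0 hp1 _ _)
  have key : ∑' e : (c' : BoundaryConfig N B) × ExitTarget B c'.1,
      ENNReal.ofReal (GGF p c e.2.1 * stepWeight p e.1.1 e.2.1 * GGF p e.1.1 c₀) =
      ENNReal.ofReal (GGF p c c₀) := by
    rw [ofReal_GGF hp0 hp1, tsum_exit_paths hB hp0 hp1 hc₀ hc₀B hc]
    refine (tsum_congr fun e => ?_).trans (ENNReal.tsum_sigma' _).symm
    rw [ENNReal.tsum_prod']
    simp only [ENNReal.tsum_mul_left, ENNReal.tsum_mul_right]
    rw [← ofReal_GGF hp0 hp1, ← ofReal_GGF hp0 hp1, ← ENNReal.ofReal_mul (GGF_nonneg hp0 hp1 _ _),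
      ← ENNReal.ofReal_mul (mul_nonneg (GGF_nonneg hp0 hp1 _ _) (stepWeight_nonneg hp0 hp1 _ _))]
    congr 1
    ring
  -- Finiteness of the extended sum yields genuine summability in `ℝ`, not just equality of `tsum`
  -- values.
  have h := ENNReal.hasSum_toReal (key ▸ ENNReal.ofReal_ne_top)
  rw [← ENNReal.tsum_toReal_eq (fun _ => ENNReal.ofReal_ne_top), key,
    ENNReal.toReal_ofReal (GGF_nonneg hp0 hp1 _ _)] at h
  simpa only [ENNReal.toReal_ofReal (hnn _)] using h

end finite

end TASEP

theorem mainTheorem3 (N : ℕ) (p : ℝ) (hp0 : 0 < p) (hp1 : p < 1)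
    (B : Set (ℤ × ℤ)) (hB : TASEP.IsBoundary B)
    (c₀ : TASEP.Config N) (hc₀ : TASEP.Admissible c₀)
    (hc₀B : ∀ i, c₀ i ∈ TASEP.under (TASEP.NBoundary N B i)) :
    (∃ μ : PMF (TASEP.BoundaryConfig N B), ∀ c : TASEP.BoundaryConfig N B,
      TASEP.exitProb p B c.1 * TASEP.GGF p c.1 c₀ = (μ c).toReal) ∧
    (∀ c : TASEP.Config N, TASEP.Admissible c →
      (∀ i, c i ∉ TASEP.under (TASEP.NBoundary N B i)) →
      HasSum
        (fun e : (c' : TASEP.BoundaryConfig N B) × TASEP.ExitTarget B c'.1 =>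
          TASEP.GGF p c e.2.1 * TASEP.stepWeight p e.1.1 e.2.1 * TASEP.GGF p e.1.1 c₀)
        (TASEP.GGF p c c₀)) := by
  refine ⟨⟨⟨fun c => ENNReal.ofReal (TASEP.exitProb p B c.1 * TASEP.GGF p c.1 c₀), ?_⟩, ?_⟩, ?_⟩
  · rw [← TASEP.tsum_exitProb_mul_GGF hB hp0 hp1 hc₀ hc₀B]
    exact ENNReal.summable.hasSum
  · exact fun c => (ENNReal.toReal_ofReal (mul_nonneg (TASEP.exitProb_nonneg hp0 hp1 _ _)
      (TASEP.GGF_nonneg hp0 hp1 _ _))).symm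
  · exact fun c _ hc => TASEP.hasSum_GGF_exit hB hp0 hp1 hc₀ hc₀B hc
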